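/- Let $n\ge 1$ be an integer, let $\alpha\in\mathbb R$, and let $f:(\alpha,\infty)\to\mathbb R$ be a function. Call $f$ $n$-monotone if $A\le B$ implies $f(A)\le f(B)$ for all Hermitian complex $n\times n$ matrices $A,B$ with spectra in $(\alpha,\infty)$, and $n$-convex if $f(\lambda A+(1-\lambda)B)\le\lambda f(A)+(1-\lambda)f(B)$ for all such $A,B$ and all $\lambda\in[0,1]$; here $f(A)$ is given by the functional calculus, and $\le$ between matrices means that the difference is positive semidefinite. (i) If $f$ is $n$-monotone and $2n-1$ times continuously differentiable, then $$(-1)^k f^{(k+1)}(t)\ge 0\qquad\text{for all } t>\alpha,\ k=0,1,\dots,2n-2.$$ Moreover, $f^{(m)}$ is concave on $(\alpha,\infty)$ for every even $m$ with $0\le m\le 2n-4$ (in particular $f=f^{(0)}$ is concave if $n\ge 2$), and $f^{(m)}$ is convex on $(\alpha,\infty)$ for every odd $m$ with $1\le m\le 2n-3$. (ii) If $f$ is $n$-convex and $2n$ times continuously differentiable, then $$(-1)^k f^{(k+2)}(t)\ge 0\qquad\text{for all } t>\alpha,\ k=0,1,\dots,2n-2.$$ Moreover, $f^{(m)}$ is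 convex on $(\alpha,\infty)$ for every even $m$ with $0\le m\le 2n-2$ (in particular $f=f^{(0)}$ is convex), and $f^{(m)}$ is concave on $(\alpha,\infty)$ for every odd $m$ with $1\le m\le 2n-3$. -/

import Mathlib

open Set
open scoped MatrixOrder ComplexOrder

/-- `f` is `n`-monotone on `I`: `A ≤ B` implies `f(A) ≤ f(B)` for Hermitian complex `n × n`
matrices with spectra in `I`. Here `≤` is the Loewner order and `cfc f A` is the functional
calculus `f(A)`; every function is continuous on the finite spectrum of a matrix, so no
continuity of `f` is needed for `cfc f A` to have its usual meaning. -/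
def IsMatrixMonotoneOn (n : ℕ) (I : Set ℝ) (f : ℝ → ℝ) : Prop :=
  ∀ A B : Matrix (Fin n) (Fin n) ℂ, A.IsHermitian → B.IsHermitian →
    spectrum ℝ A ⊆ I → spectrum ℝ B ⊆ I → A ≤ B → cfc f A ≤ cfc f B

/-- `f` is `n`-convex on `I`: `f(lA + (1-l)B) ≤ l f(A) + (1-l) f(B)` for `l ∈ [0,1]` and Hermitian
complex `n × n` matrices with spectra in `I`. -/
def IsMatrixConvexOn (n : ℕ) (I : Set ℝ) (f : ℝ → ℝ) : Prop :=
  ∀ A B : Matrix (Fin n) (Fin n) ℂ, A.IsHermitian → B.IsHermitian →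
    spectrum ℝ A ⊆ I → spectrum ℝ B ⊆ I → ∀ l : ℝ, l ∈ Icc (0 : ℝ) 1 →
      cfc f (l • A + (1 - l) • B) ≤ l • cfc f A + (1 - l) • cfc f B

/-! Test the hypothesis on `t + ε T_s`, where `T_s` is the path adjacency matrix with a loop of
weight `s` at vertex 0. For `s = ±1` the two matrices differ by `2ε` times a matrix unit, so they
are ordered; for convexity, `s = 0` is their midpoint. Entries of `T_s ^ k` count weighted walks.
The difference `T_1 ^ k - T_{-1} ^ k` sees only walks using the loop an odd number of times, the
shortest from `i` to `l` having length `i + l + 1`; the second difference needs two loops, hence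
length `i + l + 2`. Taylor expansion, rescaling by `diag(ε^{-i})` and `ε → 0` make the Hankel matrix
`f^(i+l+d) / (i+l+d)!` positive semidefinite, with `d = 1` or `2` (`hankel_nonneg_of_posSemidef`).
Its diagonal gives the even signs. Its contiguous minors give `g g'' ≥ (1 + c) g'^2` with `c > 0`;
where `g > 0` this says that `g ^ (-c)` is concave, and a positive concave function on a half-line
cannot decrease. Hence `g' ≤ 0` (`deriv_nonpos_of_mul_deriv2_ge`), which gives the odd signs. -/

/-! ### Leading entries of powers of the tridiagonal matrices -/

section Tridiagonal

variable {n : ℕ}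

/-- The `n × n` tridiagonal matrix with ones next to the diagonal, zero diagonal, except for the
entry `s` in the top left corner. -/
def tridiag (n : ℕ) (s : ℂ) : Matrix (Fin n) (Fin n) ℂ := fun i l =>
  if (i : ℕ) = l + 1 ∨ (l : ℕ) = i + 1 then 1 else if (i : ℕ) = 0 ∧ (l : ℕ) = 0 then s else 0

/-- The `n × n` matrix unit in the top left corner. -/
def cornerUnit (n : ℕ) : Matrix (Fin n) (Fin n) ℂ := fun i l =>
  if (i : ℕ) = 0 ∧ (l : ℕ) = 0 then 1 else 0

theorem tridiag_eq_add (s : ℂ) : tridiag n s = tridiag n 0 + s • cornerUnit n := by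
  ext i l
  simp only [tridiag, cornerUnit, Matrix.add_apply, Matrix.smul_apply, smul_eq_mul]
  split_ifs with h1 h2 h2 <;> first | omega | simp

theorem isHermitian_tridiag (s : ℝ) : (tridiag n (s : ℂ)).IsHermitian := by
  ext i l
  simp only [tridiag, Matrix.conjTranspose_apply]
  split_ifs <;> first | omega | simp

theorem tridiag_eq_zero {s : ℂ} {i l : Fin n} (h : (l : ℕ) + 1 < i ∨ (i : ℕ) + 1 < l) :
    tridiag n s i l = 0 := by
  rw [tridiag, if_neg (by omega), if_neg (by omega)]

/-- A walk from 0 to `l` with at most `l` steps must go straight up, so the loop weight `s` plays no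
role. -/
theorem tridiag_pow_row_zero (s : ℂ) (k : ℕ) (i l : Fin n) (hi : (i : ℕ) = 0)
    (hk : k ≤ (l : ℕ)) : (tridiag n s ^ k) i l = if k = (l : ℕ) then 1 else 0 := by
  induction k generalizing l with
  | zero =>
    rw [pow_zero, Matrix.one_apply]
    exact if_congr (by rw [Fin.ext_iff, hi]) rfl rfl
  | succ k ih =>
    rw [pow_succ, Matrix.mul_apply, Finset.sum_eq_single (⟨k, by omega⟩ : Fin n)]
    · rw [ih _ le_rfl]
      by_cases h : k + 1 = (l : ℕ)
      · simp [tridiag, ← h]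
      · rw [if_neg h, tridiag_eq_zero (Or.inr (by simp; omega)), mul_zero]
    · intro m _ hm
      have hm' : (m : ℕ) ≠ k := fun h => hm (Fin.ext h)
      by_cases h : k ≤ (m : ℕ)
      · rw [ih m h, if_neg (Ne.symm hm'), zero_mul]
      · rw [tridiag_eq_zero (Or.inr (by omega)), mul_zero]
    · simp

theorem cornerUnit_mul_apply (V : Matrix (Fin n) (Fin n) ℂ) (i l : Fin n) :
    (cornerUnit n * V) i l = if (i : ℕ) = 0 then V i l else 0 := by
  rw [Matrix.mul_apply]
  split_ifs with hi
  · rw [Finset.sum_eq_single i]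
    · simp [cornerUnit, hi]
    · intro m _ hm
      have : (m : ℕ) ≠ 0 := fun h => hm (Fin.ext (by omega))
      simp [cornerUnit, this]
    · simp
  · simp [cornerUnit, hi]

/-- `V` feeds only row 0, and each multiplication by the tridiagonal matrix carries the leading
entry one row down. Contributions from the same row or from below are of too low an order and
vanish. -/
theorem tridiag_recurrence_apply {s c : ℂ} {d : ℕ} {U V : ℕ → Matrix (Fin n) (Fin n) ℂ}
    (h0 : U 0 = 0) (hU : ∀ k, U (k + 1) = tridiag n s * U k + cornerUnit n * V k)
    (hV : ∀ (k : ℕ) (i l : Fin n), (i : ℕ) = 0 → k ≤ l + d →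
      V k i l = if k = (l : ℕ) + d then c else 0)
    (k : ℕ) (i l : Fin n) (hk : k ≤ i + l + (d + 1)) :
    U k i l = if k = (i : ℕ) + l + (d + 1) then c else 0 := by
  induction k generalizing i with
  | zero => rw [h0, if_neg (by omega)]; rfl
  | succ k ih =>
    rw [hU, Matrix.add_apply, cornerUnit_mul_apply, Matrix.mul_apply]
    by_cases hi : (i : ℕ) = 0
    · rw [if_pos hi, hV k i l hi (by omega), Finset.sum_eq_zero, zero_add]
      · exact if_congr (by omega) rfl rfl
      · intro m _
        rw [ih m (by omega), if_neg (by omega), mul_zero]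
    · rw [if_neg hi, add_zero, Finset.sum_eq_single (⟨i - 1, by omega⟩ : Fin n)]
      · rw [ih _ (by simp; omega), tridiag, if_pos (Or.inl (by simp; omega)), one_mul]
        exact if_congr (by simp; omega) rfl rfl
      · intro m _ hm
        have hm' : (m : ℕ) ≠ i - 1 := fun h => hm (Fin.ext h)
        by_cases h : (m : ℕ) + 1 < i
        · rw [tridiag_eq_zero (Or.inl h), zero_mul]
        · rw [ih m (by omega), if_neg (by omega), mul_zero]
      · simp

theorem tridiag_pow_sub_pow_apply (k : ℕ) (i l : Fin n) (hk : k ≤ i + l + 1) :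
    (tridiag n 1 ^ k - tridiag n (-1) ^ k) i l = if k = (i : ℕ) + l + 1 then 2 else 0 := by
  refine tridiag_recurrence_apply (s := 1) (c := 2) (d := 0)
    (U := fun k => tridiag n 1 ^ k - tridiag n (-1) ^ k)
    (V := fun k => (2 : ℂ) • tridiag n (-1) ^ k) (by simp) (fun k => ?_) (fun k i l hi hk => ?_)
    k i l hk
  -- With `E` the corner unit, `T_1 = T_{-1} + 2E`, so the source term is `2E T_{-1} ^ k`.
  · rw [pow_succ', pow_succ', mul_sub, Matrix.mul_smul, ← Matrix.smul_mul,
      show tridiag n 1 = tridiag n (-1) + (2 : ℂ) • cornerUnit n by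
        rw [tridiag_eq_add 1, tridiag_eq_add (-1), add_assoc, ← add_smul]; norm_num]
    noncomm_ring
  · rw [Matrix.smul_apply, tridiag_pow_row_zero _ k i l hi hk]
    simp

theorem tridiag_pow_second_difference_apply (k : ℕ) (i l : Fin n) (hk : k ≤ i + l + 2) :
    (tridiag n 1 ^ k + tridiag n (-1) ^ k - (2 : ℂ) • tridiag n 0 ^ k) i l =
      if k = (i : ℕ) + l + 2 then 2 else 0 := by
  refine tridiag_recurrence_apply (s := 0) (c := 2) (d := 1)
    (U := fun k => tridiag n 1 ^ k + tridiag n (-1) ^ k - (2 : ℂ) • tridiag n 0 ^ k)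
    (V := fun k => tridiag n 1 ^ k - tridiag n (-1) ^ k) ?_ (fun k => ?_)
    (fun k i l hi hk => ?_) k i l hk
  · simp [two_smul]
  -- Since `T_{±1} = T_0 ± E`, the source term is `E` times the first difference, whose row 0 is
  -- already known.
  · simp only [pow_succ' _ k, two_smul]
    rw [show tridiag n 1 * tridiag n 1 ^ k = (tridiag n 0 + cornerUnit n) * tridiag n 1 ^ k by
        rw [tridiag_eq_add 1, one_smul],
      show tridiag n (-1) * tridiag n (-1) ^ k
          = (tridiag n 0 - cornerUnit n) * tridiag n (-1) ^ k by
        rw [tridiag_eq_add (-1), neg_one_smul, sub_eq_add_neg]]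
    noncomm_ring
  · rw [tridiag_pow_sub_pow_apply k i l (by omega), hi, zero_add]

end Tridiagonal

/-! ### Expansions in `ε` and their leading terms -/

section Expansion

open Filter Topology

/-- `G ε = ∑_{k ≤ N} h k * ε ^ k * u k + o(ε ^ N)` as `ε → 0+`. -/
def HasExpansion (h : ℕ → ℝ) (N : ℕ) (G : ℝ → ℂ) (u : ℕ → ℂ) : Prop :=
  ∃ ρ : ℝ → ℂ, Tendsto ρ (𝓝[>] 0) (𝓝 0) ∧ ∀ᶠ ε : ℝ in 𝓝[>] 0,
    G ε = ∑ k ∈ Finset.range (N + 1), ((h k * ε ^ k : ℝ) : ℂ) * u k + ((ε ^ N : ℝ) : ℂ) * ρ ε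

namespace HasExpansion

variable {h : ℕ → ℝ} {N : ℕ} {G G' : ℝ → ℂ} {u u' : ℕ → ℂ}

theorem add (hG : HasExpansion h N G u) (hG' : HasExpansion h N G' u') :
    HasExpansion h N (fun ε => G ε + G' ε) (fun k => u k + u' k) := by
  obtain ⟨ρ, hρ, e⟩ := hG
  obtain ⟨ρ', hρ', e'⟩ := hG'
  refine ⟨fun ε => ρ ε + ρ' ε, by simpa using hρ.add hρ', ?_⟩
  filter_upwards [e, e'] with ε h1 h2
  rw [h1, h2]
  simp only [mul_add, Finset.sum_add_distrib]
  ring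

theorem const_mul (c : ℂ) (hG : HasExpansion h N G u) :
    HasExpansion h N (fun ε => c * G ε) (fun k => c * u k) := by
  obtain ⟨ρ, hρ, e⟩ := hG
  refine ⟨fun ε => c * ρ ε, by simpa using hρ.const_mul c, ?_⟩
  filter_upwards [e] with ε h1
  rw [h1, mul_add, Finset.mul_sum]
  congr 1
  · exact Finset.sum_congr rfl fun k _ => by ring
  · ring

theorem sub (hG : HasExpansion h N G u) (hG' : HasExpansion h N G' u') :
    HasExpansion h N (fun ε => G ε - G' ε) (fun k => u k - u' k) := by
  simpa only [neg_one_mul, ← sub_eq_add_neg] using hG.add (hG'.const_mul (-1))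

theorem tendsto_leading {c : ℂ} {e : ℕ} (hG : HasExpansion h N G u) (he : e ≤ N)
    (hu : ∀ k ≤ e, u k = if k = e then c else 0) :
    Tendsto (fun ε : ℝ => (((ε ^ e)⁻¹ : ℝ) : ℂ) * G ε) (𝓝[>] 0) (𝓝 (h e * c)) := by
  obtain ⟨ρ, hρ, hG⟩ := hG
  have hpow : ∀ j : ℕ, Tendsto (fun ε : ℝ => ((ε ^ j : ℝ) : ℂ)) (𝓝[>] 0)
      (𝓝 (((0 : ℝ) ^ j : ℝ) : ℂ)) := fun j =>
    ((by fun_prop : Continuous fun ε : ℝ => ((ε ^ j : ℝ) : ℂ)).tendsto 0).mono_left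
      nhdsWithin_le_nhds
  -- Truncated subtraction is harmless: terms with `k < e` have `u k = 0`. In the limit `0 ^ 0 = 1`
  -- singles out `k = e`.
  have key : Tendsto (fun ε : ℝ => ∑ k ∈ Finset.range (N + 1),
      ((ε ^ (k - e) : ℝ) : ℂ) * (h k * u k) + ((ε ^ (N - e) : ℝ) : ℂ) * ρ ε) (𝓝[>] 0)
      (𝓝 (∑ k ∈ Finset.range (N + 1), (((0 : ℝ) ^ (k - e) : ℝ) : ℂ) * (h k * u k)
        + (((0 : ℝ) ^ (N - e) : ℝ) : ℂ) * 0)) :=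
    (tendsto_finsetSum _ fun k _ => (hpow (k - e)).mul_const _).add ((hpow (N - e)).mul hρ)
  have hlim : ∑ k ∈ Finset.range (N + 1), (((0 : ℝ) ^ (k - e) : ℝ) : ℂ) * (h k * u k)
        + (((0 : ℝ) ^ (N - e) : ℝ) : ℂ) * 0 = h e * c := by
    rw [mul_zero, add_zero, Finset.sum_eq_single e]
    · simp [hu e le_rfl]
    · intro k _ hk
      rcases lt_or_gt_of_ne hk with hk | hk
      · simp [hu k hk.le, hk.ne]
      · simp [(Nat.sub_pos_of_lt hk).ne']
    · intro h
      exact absurd (Finset.mem_range.mpr (by omega)) h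
  rw [hlim] at key
  refine key.congr' ?_
  filter_upwards [hG, self_mem_nhdsWithin] with ε h1 hε
  have hε' : (ε : ℂ) ≠ 0 := by exact_mod_cast (ne_of_gt hε : ε ≠ 0)
  rw [h1, mul_add, Finset.mul_sum]
  congr 1
  · refine Finset.sum_congr rfl fun k _ => ?_
    rcases lt_or_ge k e with hk | hk
    · simp [hu k hk.le, hk.ne]
    · obtain ⟨j, rfl⟩ := Nat.exists_eq_add_of_le hk
      rw [Nat.add_sub_cancel_left]
      push_cast
      field_simp
      ring
  · obtain ⟨j, rfl⟩ := Nat.exists_eq_add_of_le he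
    rw [Nat.add_sub_cancel_left]
    push_cast
    field_simp
    ring

end HasExpansion

/-- If a family of positive semidefinite matrices is expanded in powers of `ε` with coefficients
`h k • U k`, and the first nonvanishing entries of the `U k` lie on the antidiagonals
`i + l + d = k`, where they are constant, then the Hankel matrix `h (i + l + d)` is positive
semidefinite. -/
theorem hankel_nonneg_of_posSemidef {n N d : ℕ} {C : ℝ} {h : ℕ → ℝ}
    {M : ℝ → Matrix (Fin n) (Fin n) ℂ} {U : ℕ → Matrix (Fin n) (Fin n) ℂ}
    (hM : ∀ᶠ ε : ℝ in 𝓝[>] 0, (M ε).PosSemidef)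
    (hexp : ∀ i l, HasExpansion h N (fun ε => M ε i l) (fun k => U k i l))
    (hC : 0 < C) (hN : 2 * n + d ≤ N + 2)
    (hU : ∀ k (i l : Fin n), k ≤ (i : ℕ) + l + d →
      U k i l = if k = (i : ℕ) + l + d then (C : ℂ) else 0) (c : Fin n → ℝ) :
    0 ≤ ∑ i, ∑ l, c i * c l * h (i + l + d) := by
  have hlim : Tendsto (fun ε : ℝ => ∑ i : Fin n, ∑ l : Fin n,
      ((c i * c l : ℝ) : ℂ) * ((((ε ^ ((i : ℕ) + l + d))⁻¹ : ℝ) : ℂ) * M ε i l)) (𝓝[>] 0)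
      (𝓝 (∑ i : Fin n, ∑ l : Fin n, ((c i * c l : ℝ) : ℂ) * (h (i + l + d) * C))) :=
    tendsto_finsetSum _ fun i _ => tendsto_finsetSum _ fun l _ =>
      ((hexp i l).tendsto_leading (by omega) (fun k hk => hU k i l hk)).const_mul _
  have hre := (Complex.continuous_re.tendsto _).comp hlim
  have hnn : 0 ≤ (∑ i : Fin n, ∑ l : Fin n,
      ((c i * c l : ℝ) : ℂ) * (h (i + l + d) * C) : ℂ).re := by
    refine ge_of_tendsto hre ?_
    filter_upwards [hM, self_mem_nhdsWithin] with ε hε hpos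
    have hε0 : (0 : ℝ) < ε := hpos
    -- The test vector `c i * ε^{-i}` rescales entry `(i, l)` by `ε^{-(i+l)}`; the remaining
    -- `ε^{-d}` is a positive scalar.
    have h1 := (Complex.le_def.mp
      (hε.dotProduct_mulVec_nonneg fun i => ((c i * (ε ^ (i : ℕ))⁻¹ : ℝ) : ℂ))).1
    have h2 : (∑ i : Fin n, ∑ l : Fin n,
        ((c i * c l : ℝ) : ℂ) * ((((ε ^ ((i : ℕ) + l + d))⁻¹ : ℝ) : ℂ) * M ε i l)) =
        (((ε ^ d)⁻¹ : ℝ) : ℂ) * (star (fun i : Fin n => ((c i * (ε ^ (i : ℕ))⁻¹ : ℝ) : ℂ)) ⬝ᵥ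
          (M ε).mulVec fun i => ((c i * (ε ^ (i : ℕ))⁻¹ : ℝ) : ℂ)) := by
      simp only [dotProduct, Matrix.mulVec, Finset.mul_sum, Pi.star_apply]
      refine Finset.sum_congr rfl fun i _ => Finset.sum_congr rfl fun l _ => ?_
      rw [Complex.star_def, Complex.conj_ofReal, pow_add, pow_add]
      push_cast
      rw [mul_inv, mul_inv]
      ring
    rw [Function.comp_apply, h2, Complex.re_ofReal_mul]
    exact mul_nonneg (by positivity) h1
  have hcast : (∑ i : Fin n, ∑ l : Fin n,
      ((c i * c l : ℝ) : ℂ) * (h (i + l + d) * C) : ℂ).re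
      = C * ∑ i, ∑ l, c i * c l * h (i + l + d) := by
    rw [← Complex.ofReal_re (C * _)]
    congr 1
    push_cast
    simp only [Finset.mul_sum]
    exact Finset.sum_congr rfl fun i _ => Finset.sum_congr rfl fun l _ => by ring
  rw [hcast] at hnn
  exact nonneg_of_mul_nonneg_right hnn hC

/-! ### Functional calculus along `t + ε X` -/

variable {n : ℕ}

/-- The fixed `X` is diagonalized once, so convergence at its finitely many eigenvalues suffices;
this lets a pointwise Taylor remainder serve for matrices. -/
theorem Matrix.IsHermitian.tendsto_cfc_zero {X : Matrix (Fin n) (Fin n) ℂ} (hX : X.IsHermitian)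
    {F : Filter ℝ} {r : ℝ → ℝ → ℝ} (hr : ∀ x, Tendsto (fun ε => r ε x) F (𝓝 0)) :
    Tendsto (fun ε => cfc (r ε) X) F (𝓝 0) := by
  have hD : Tendsto (fun ε => Matrix.diagonal (RCLike.ofReal ∘ r ε ∘ hX.eigenvalues) :
      ℝ → Matrix (Fin n) (Fin n) ℂ) F (𝓝 0) := by
    rw [← Matrix.diagonal_zero]
    refine (Continuous.matrix_diagonal continuous_id).tendsto _ |>.comp (tendsto_pi_nhds.mpr ?_)
    intro i
    have := (Complex.continuous_ofReal.tendsto 0).comp (hr (hX.eigenvalues i))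
    simpa [Function.comp_def] using this
  have h := (tendsto_const_nhds (x := (hX.eigenvectorUnitary : Matrix (Fin n) (Fin n) ℂ))).mul hD
    |>.mul (tendsto_const_nhds (x := star (hX.eigenvectorUnitary : Matrix (Fin n) (Fin n) ℂ)))
  rw [mul_zero, zero_mul] at h
  refine h.congr fun ε => ?_
  rw [hX.cfc_eq, Matrix.IsHermitian.cfc, Unitary.conjStarAlgAut_apply]

theorem Matrix.continuousOn_spectrum (X : Matrix (Fin n) (Fin n) ℂ) (g : ℝ → ℝ) :
    ContinuousOn g (spectrum ℝ X) :=
  X.finite_real_spectrum.continuousOn g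

theorem Matrix.IsHermitian.cfc_affine {X : Matrix (Fin n) (Fin n) ℂ} (hX : X.IsHermitian)
    (t ε : ℝ) : cfc (fun x => t + ε * x) X = t • (1 : Matrix (Fin n) (Fin n) ℂ) + ε • X := by
  have hX' : IsSelfAdjoint X := hX
  rw [cfc_add X (fun _ => t) (fun x => ε * x), cfc_const t X, cfc_const_mul_id ε X,
    Algebra.algebraMap_eq_smul_one]

theorem Matrix.IsHermitian.affine {X : Matrix (Fin n) (Fin n) ℂ} (hX : X.IsHermitian)
    (t ε : ℝ) : (t • (1 : Matrix (Fin n) (Fin n) ℂ) + ε • X).IsHermitian := by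
  rw [← hX.cfc_affine]
  exact cfc_predicate _ X

theorem Matrix.IsHermitian.eventually_spectrum_affine {X : Matrix (Fin n) (Fin n) ℂ}
    (hX : X.IsHermitian) {s : Set ℝ} {t : ℝ} (hs : s ∈ 𝓝 t) :
    ∀ᶠ ε : ℝ in 𝓝[>] 0, spectrum ℝ (t • (1 : Matrix (Fin n) (Fin n) ℂ) + ε • X) ⊆ s := by
  have hX' : IsSelfAdjoint X := hX
  have h : ∀ᶠ ε : ℝ in 𝓝[>] 0, ∀ x ∈ spectrum ℝ X, t + ε * x ∈ s := by
    rw [eventually_all_finite X.finite_real_spectrum]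
    intro x _
    have : Tendsto (fun ε : ℝ => t + ε * x) (𝓝[>] 0) (𝓝 t) := by
      simpa using ((by fun_prop : Continuous fun ε : ℝ => t + ε * x).tendsto 0).mono_left
        nhdsWithin_le_nhds
    exact this hs
  filter_upwards [h] with ε hε
  rw [← hX.cfc_affine, cfc_map_spectrum (fun x => t + ε * x) X]
  rintro _ ⟨x, hx, rfl⟩
  exact hε x hx

theorem tendsto_taylor_remainder {f : ℝ → ℝ} {s : Set ℝ} {t : ℝ} {N : ℕ} (hs : IsOpen s)
    (hc : Convex ℝ s) (ht : t ∈ s) (hf : ContDiffOn ℝ N f s) (x : ℝ) :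
    Tendsto (fun ε : ℝ => (f (t + ε * x) - ∑ k ∈ Finset.range (N + 1),
      iteratedDeriv k f t / k.factorial * ε ^ k * x ^ k) / ε ^ N) (𝓝[>] 0) (𝓝 0) := by
  have h := taylor_isLittleO hc ht hf
  rw [hs.nhdsWithin_eq ht] at h
  have hφ : Tendsto (fun ε : ℝ => t + ε * x) (𝓝[>] 0) (𝓝 t) := by
    simpa using ((by fun_prop : Continuous fun ε : ℝ => t + ε * x).tendsto 0).mono_left
      nhdsWithin_le_nhds
  have h1 := h.comp_tendsto hφ
  have h2 : ((fun y => (y - t) ^ N) ∘ fun ε : ℝ => t + ε * x) =O[𝓝[>] 0] fun ε : ℝ => ε ^ N := by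
    refine (Asymptotics.isBigO_const_mul_self (x ^ N) (fun ε : ℝ => ε ^ N) _).congr_left
      fun ε => ?_
    simp [mul_pow, mul_comm]
  refine ((h1.trans_isBigO h2).tendsto_div_nhds_zero).congr fun ε => ?_
  simp only [Function.comp_apply, taylor_within_apply]
  congr 2
  refine Finset.sum_congr rfl fun k _ => ?_
  rw [iteratedDerivWithin_of_isOpen hs ht, smul_eq_mul, add_sub_cancel_left, mul_pow]
  ring

/-- The Taylor expansion of `f (t + ε X)` for a Hermitian matrix `X`. -/
theorem Matrix.IsHermitian.hasExpansion_cfc {X : Matrix (Fin n) (Fin n) ℂ} (hX : X.IsHermitian)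
    {f : ℝ → ℝ} {s : Set ℝ} {t : ℝ} {N : ℕ} (hs : IsOpen s)
    (hc : Convex ℝ s) (ht : t ∈ s) (hf : ContDiffOn ℝ N f s) (i l : Fin n) :
    HasExpansion (fun k => iteratedDeriv k f t / k.factorial) N
      (fun ε => cfc f (t • (1 : Matrix (Fin n) (Fin n) ℂ) + ε • X) i l)
      (fun k => (X ^ k) i l) := by
  have hX' : IsSelfAdjoint X := hX
  have hcont := X.continuousOn_spectrum
  set r : ℝ → ℝ → ℝ := fun ε x => (f (t + ε * x) - ∑ k ∈ Finset.range (N + 1),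
      iteratedDeriv k f t / k.factorial * ε ^ k * x ^ k) / ε ^ N with hr
  refine ⟨fun ε => cfc (r ε) X i l, ?_, ?_⟩
  · have h := hX.tendsto_cfc_zero (tendsto_taylor_remainder hs hc ht hf)
    exact tendsto_pi_nhds.mp (tendsto_pi_nhds.mp h i) l
  · filter_upwards [self_mem_nhdsWithin] with ε hε
    have hε' : ε ^ N ≠ 0 := pow_ne_zero _ (ne_of_gt hε)
    have h1 : cfc f (t • (1 : Matrix (Fin n) (Fin n) ℂ) + ε • X)
        = cfc (fun x => f (t + ε * x)) X := by
      rw [← hX.cfc_affine, cfc_comp' f (fun x => t + ε * x) X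
        ((X.finite_real_spectrum.image _).continuousOn f) (hcont _)]
    have h2 : (fun x => f (t + ε * x)) = fun x =>
        (∑ k ∈ Finset.range (N + 1), fun x : ℝ =>
          (iteratedDeriv k f t / k.factorial * ε ^ k) * x ^ k) x + ε ^ N * r ε x := by
      funext x
      rw [Finset.sum_apply, hr]
      field_simp
      ring
    rw [h1, h2, cfc_add X _ _ (hcont _) (hcont _), cfc_sum _ _ _ fun _ _ => hcont _,
      cfc_const_mul _ _ X (hcont _), Matrix.add_apply, Matrix.sum_apply, Matrix.smul_apply,
      Complex.real_smul]
    congr 1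
    refine Finset.sum_congr rfl fun k _ => ?_
    rw [cfc_const_mul _ _ X (hcont _), cfc_pow_id X k, Matrix.smul_apply, Complex.real_smul]

end Expansion

/-! ### A differential inequality on a half-line -/

section HalfLine

/-- A nonnegative convex function on a half-line with `g g'' ≥ (1 + c) g'^2` for some `c > 0`
is nonincreasing. -/
theorem deriv_nonpos_of_mul_deriv2_ge {α c : ℝ} {g g₁ g₂ : ℝ → ℝ} (hc : 0 < c)
    (hg : ∀ t ∈ Ioi α, HasDerivAt g (g₁ t) t) (hg₁ : ∀ t ∈ Ioi α, HasDerivAt g₁ (g₂ t) t)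
    (h0 : ∀ t ∈ Ioi α, 0 ≤ g t) (h2 : ∀ t ∈ Ioi α, 0 ≤ g₂ t)
    (h : ∀ t ∈ Ioi α, (1 + c) * g₁ t ^ 2 ≤ g t * g₂ t) : ∀ t ∈ Ioi α, g₁ t ≤ 0 := by
  intro a ha
  by_contra! hpos
  have hsub : Ici a ⊆ Ioi α := Ici_subset_Ioi.mpr ha
  have hmono : MonotoneOn g₁ (Ici a) := by
    refine monotoneOn_of_deriv_nonneg (convex_Ici a)
      (fun t ht => (hg₁ t (hsub ht)).continuousAt.continuousWithinAt)
      (fun t ht => (hg₁ t (hsub (interior_subset ht))).differentiableAt.differentiableWithinAt)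
      (fun t ht => ?_)
    rw [(hg₁ t (hsub (interior_subset ht))).deriv]
    exact h2 t (hsub (interior_subset ht))
  have hp : ∀ t ∈ Ici a, 0 < g₁ t := fun t ht => hpos.trans_le (hmono self_mem_Ici ht ht)
  -- `(g / g')' = 1 - g g'' / g'^2 ≤ -c`, so `g / g'` would eventually become negative.
  have hq : ∀ t ∈ Ici a, HasDerivAt (fun t => g t / g₁ t + c * t)
      ((g₁ t * g₁ t - g t * g₂ t) / g₁ t ^ 2 + c * 1) t := fun t ht =>
    ((hg t (hsub ht)).div (hg₁ t (hsub ht)) (hp t ht).ne').add ((hasDerivAt_id t).const_mul c)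
  have hanti : AntitoneOn (fun t => g t / g₁ t + c * t) (Ici a) := by
    refine antitoneOn_of_deriv_nonpos (convex_Ici a)
      (fun t ht => (hq t ht).continuousAt.continuousWithinAt)
      (fun t ht => (hq t (interior_subset ht)).differentiableAt.differentiableWithinAt)
      (fun t ht => ?_)
    have ht' := interior_subset ht
    have h1 := hp t ht'
    rw [(hq t ht').deriv, mul_one]
    have : (g₁ t * g₁ t - g t * g₂ t) / g₁ t ^ 2 ≤ -c := by
      rw [div_le_iff₀ (by positivity)]
      linarith [h t (hsub ht')]
    linarith
  -- Chosen so that the linear bound forces `g b / g₁ b ≤ -1`.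
  set b := a + (g a / g₁ a + 1) / c with hb
  have hga : 0 ≤ g a / g₁ a := div_nonneg (h0 a ha) hpos.le
  have hab : a ≤ b := le_add_of_nonneg_right (by positivity)
  have h3 := hanti self_mem_Ici hab hab
  have h4 : 0 ≤ g b / g₁ b := div_nonneg (h0 b (hsub hab)) (hp b hab).le
  have h5 : c * b = c * a + (g a / g₁ a + 1) := by rw [hb]; field_simp
  simp only at h3
  linarith

end HalfLine

/-! ### Positive semidefinite Hankel matrices of derivatives -/

section Hankel

open Filter Topology

variable {n : ℕ} {f : ℝ → ℝ} {s : Set ℝ} {t : ℝ}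

theorem IsMatrixMonotoneOn.hankel_nonneg (hf : IsMatrixMonotoneOn n s f) (hs : IsOpen s)
    (hc : Convex ℝ s) (ht : t ∈ s) (hd : ContDiffOn ℝ ((2 * n - 1 : ℕ) : WithTop ℕ∞) f s)
    (c : Fin n → ℝ) :
    0 ≤ ∑ i : Fin n, ∑ l : Fin n, c i * c l *
      (iteratedDeriv (i + l + 1) f t / (i + l + 1 : ℕ).factorial) := by
  rcases Nat.eq_zero_or_pos n with rfl | hn
  · simp
  have hX : (tridiag n (-1)).IsHermitian := by simpa using isHermitian_tridiag (n := n) (-1)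
  have hY : (tridiag n 1).IsHermitian := by simpa using isHermitian_tridiag (n := n) 1
  refine hankel_nonneg_of_posSemidef (N := 2 * n - 1) (C := 2)
    (h := fun k => iteratedDeriv k f t / k.factorial)
    (M := fun ε => cfc f (t • (1 : Matrix (Fin n) (Fin n) ℂ) + ε • tridiag n 1)
      - cfc f (t • (1 : Matrix (Fin n) (Fin n) ℂ) + ε • tridiag n (-1)))
    (U := fun k => tridiag n 1 ^ k - tridiag n (-1) ^ k)
    ?_ (fun i l => (hY.hasExpansion_cfc hs hc ht hd i l).sub
      (hX.hasExpansion_cfc hs hc ht hd i l)) two_pos (by omega) ?_ c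
  · filter_upwards [hX.eventually_spectrum_affine (hs.mem_nhds ht),
      hY.eventually_spectrum_affine (hs.mem_nhds ht), self_mem_nhdsWithin] with ε h1 h2 hε
    refine Matrix.le_iff.mp (hf _ _ (hX.affine t ε) (hY.affine t ε) h1 h2 ?_)
    rw [Matrix.le_iff, show t • (1 : Matrix (Fin n) (Fin n) ℂ) + ε • tridiag n 1
      - (t • (1 : Matrix (Fin n) (Fin n) ℂ) + ε • tridiag n (-1)) = Matrix.diagonal
        fun i : Fin n => if (i : ℕ) = 0 then ((2 * ε : ℝ) : ℂ) else 0 from ?_]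
    · refine Matrix.PosSemidef.diagonal fun i => ?_
      have : (0 : ℝ) ≤ 2 * ε := by
        have : (0 : ℝ) < ε := hε
        positivity
      simp only [Pi.zero_apply]
      split_ifs
      · exact_mod_cast this
      · exact le_rfl
    · rw [add_sub_add_left_eq_sub, tridiag_eq_add 1, tridiag_eq_add (-1)]
      ext i l
      simp only [Matrix.sub_apply, Matrix.smul_apply, Matrix.add_apply, cornerUnit,
        Matrix.diagonal_apply, Fin.ext_iff, Complex.real_smul, smul_eq_mul]
      split_ifs <;> first | omega | (push_cast; ring)
  · intro k i l hk
    simpa using tridiag_pow_sub_pow_apply k i l hk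

theorem IsMatrixConvexOn.hankel_nonneg (hf : IsMatrixConvexOn n s f) (hs : IsOpen s)
    (hc : Convex ℝ s) (ht : t ∈ s) (hd : ContDiffOn ℝ ((2 * n : ℕ) : WithTop ℕ∞) f s)
    (c : Fin n → ℝ) :
    0 ≤ ∑ i : Fin n, ∑ l : Fin n, c i * c l *
      (iteratedDeriv (i + l + 2) f t / (i + l + 2 : ℕ).factorial) := by
  have hX : (tridiag n (-1)).IsHermitian := by simpa using isHermitian_tridiag (n := n) (-1)
  have hY : (tridiag n 1).IsHermitian := by simpa using isHermitian_tridiag (n := n) 1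
  have hZ : (tridiag n 0).IsHermitian := by simpa using isHermitian_tridiag (n := n) 0
  refine hankel_nonneg_of_posSemidef (N := 2 * n) (C := 2)
    (h := fun k => iteratedDeriv k f t / k.factorial)
    (M := fun ε => cfc f (t • (1 : Matrix (Fin n) (Fin n) ℂ) + ε • tridiag n 1)
      + cfc f (t • (1 : Matrix (Fin n) (Fin n) ℂ) + ε • tridiag n (-1))
      - (2 : ℂ) • cfc f (t • (1 : Matrix (Fin n) (Fin n) ℂ) + ε • tridiag n 0))
    (U := fun k => tridiag n 1 ^ k + tridiag n (-1) ^ k - (2 : ℂ) • tridiag n 0 ^ k)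
    ?_ (fun i l => ((hY.hasExpansion_cfc hs hc ht hd i l).add
      (hX.hasExpansion_cfc hs hc ht hd i l)).sub
        ((hZ.hasExpansion_cfc hs hc ht hd i l).const_mul 2)) two_pos (by omega) ?_ c
  · filter_upwards [hX.eventually_spectrum_affine (hs.mem_nhds ht),
      hY.eventually_spectrum_affine (hs.mem_nhds ht)] with ε h1 h2
    -- Only midpoint convexity is used; doubling it gives the second difference.
    have h := hf _ _ (hY.affine t ε) (hX.affine t ε) h2 h1 (1 / 2) ⟨by norm_num, by norm_num⟩
    rw [show (1 / 2 : ℝ) • (t • (1 : Matrix (Fin n) (Fin n) ℂ) + ε • tridiag n 1)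
      + (1 - 1 / 2 : ℝ) • (t • (1 : Matrix (Fin n) (Fin n) ℂ) + ε • tridiag n (-1))
      = t • (1 : Matrix (Fin n) (Fin n) ℂ) + ε • tridiag n 0 from ?_, Matrix.le_iff] at h
    · have h' := h.smul (zero_le_two : (0 : ℝ) ≤ 2)
      rwa [smul_sub, smul_add, smul_smul, smul_smul, show (2 : ℝ) * (1 / 2) = 1 by norm_num,
        show (2 : ℝ) * (1 - 1 / 2) = 1 by norm_num, one_smul, one_smul, two_smul ℝ,
        ← two_smul ℂ] at h'
    · rw [tridiag_eq_add 1, tridiag_eq_add (-1)]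
      ext i l
      simp only [Matrix.smul_apply, Matrix.add_apply, Complex.real_smul, smul_eq_mul]
      push_cast
      ring
  · intro k i l hk
    simpa using tridiag_pow_second_difference_apply k i l hk

/-- Diagonal entries and contiguous `2 × 2` minors of a positive semidefinite Hankel matrix. -/
theorem hankel_diag_nonneg_and_minor {h : ℕ → ℝ} {d : ℕ}
    (hh : ∀ c : Fin n → ℝ, 0 ≤ ∑ i : Fin n, ∑ l : Fin n, c i * c l * h (i + l + d)) :
    (∀ j < n, 0 ≤ h (2 * j + d)) ∧
    ∀ j, j + 1 < n → h (2 * j + d + 1) ^ 2 ≤ h (2 * j + d) * h (2 * j + d + 2) := by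
  refine ⟨fun j hj => ?_, fun j hj => ?_⟩
  · have := hh (Pi.single ⟨j, hj⟩ 1)
    simpa [Pi.single_apply, ← two_mul] using this
  · set a : Fin n := ⟨j, by omega⟩
    set b : Fin n := ⟨j + 1, hj⟩
    have hab : a ≠ b := by simp [a, b]
    have hsum : ∀ (x : ℝ) (F : Fin n → ℝ),
        ∑ i, (Pi.single a x + Pi.single b 1 : Fin n → ℝ) i * F i = x * F a + F b := by
      intro x F
      simp [add_mul, Finset.sum_add_distrib, Pi.single_apply]
    -- The form at `(x, 1)` on the indices `j, j + 1` is a quadratic in `x` that is never negative.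
    have key := discrim_le_zero (a := h (2 * j + d)) (b := 2 * h (2 * j + d + 1))
      (c := h (2 * j + d + 2)) fun x => by
        have := hh (Pi.single a x + Pi.single b 1)
        simp only [mul_assoc, ← Finset.mul_sum, hsum] at this
        simp only [a, b] at this
        rw [show j + j + d = 2 * j + d by ring, show j + (j + 1) + d = 2 * j + d + 1 by ring,
          show j + 1 + j + d = 2 * j + d + 1 by ring,
          show j + 1 + (j + 1) + d = 2 * j + d + 2 by ring] at this
        linarith
    rw [discrim] at key
    linarith

end Hankel

/-! ### Signs of the derivatives, convexity and concavity -/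

section Signs

variable {α : ℝ} {f : ℝ → ℝ} {N : ℕ}

theorem hasDerivAt_iteratedDeriv_of_contDiffOn {s : Set ℝ} (hs : IsOpen s)
    (hf : ContDiffOn ℝ N f s) {m : ℕ} (hm : m < N) {t : ℝ} (ht : t ∈ s) :
    HasDerivAt (iteratedDeriv m f) (iteratedDeriv (m + 1) f t) t := by
  have h := (hf.differentiableOn_iteratedDerivWithin (m := m) (by exact_mod_cast hm)
    hs.uniqueDiffOn).differentiableAt (hs.mem_nhds ht)
  have h' : DifferentiableAt ℝ (iteratedDeriv m f) t := h.congr_of_eventuallyEq <| by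
    filter_upwards [hs.mem_nhds ht] with x hx
    exact (iteratedDerivWithin_of_isOpen hs hx).symm
  rw [iteratedDeriv_succ]
  exact h'.hasDerivAt

theorem convexOn_iteratedDeriv {s : Set ℝ} (hs : IsOpen s) (hc : Convex ℝ s)
    (hf : ContDiffOn ℝ N f s) {m : ℕ} (hm : m + 2 ≤ N)
    (h : ∀ t ∈ s, 0 ≤ iteratedDeriv (m + 2) f t) : ConvexOn ℝ s (iteratedDeriv m f) := by
  refine convexOn_of_deriv2_nonneg' hc (fun t ht => ?_) (fun t ht => ?_) (fun t ht => ?_)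
  · exact (hasDerivAt_iteratedDeriv_of_contDiffOn hs hf
      (by omega) ht).differentiableAt.differentiableWithinAt
  · rw [← iteratedDeriv_succ]
    exact (hasDerivAt_iteratedDeriv_of_contDiffOn hs hf
      (by omega) ht).differentiableAt.differentiableWithinAt
  · simpa only [Function.iterate_succ, Function.iterate_zero, Function.comp_apply, id,
      ← iteratedDeriv_succ] using h t ht

theorem concaveOn_iteratedDeriv {s : Set ℝ} (hs : IsOpen s) (hc : Convex ℝ s)
    (hf : ContDiffOn ℝ N f s) {m : ℕ} (hm : m + 2 ≤ N)
    (h : ∀ t ∈ s, iteratedDeriv (m + 2) f t ≤ 0) : ConcaveOn ℝ s (iteratedDeriv m f) := by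
  have h1 := convexOn_iteratedDeriv (f := -f) hs hc hf.neg hm fun t ht => by
    rw [iteratedDeriv_neg]
    simpa using h t ht
  have h2 : iteratedDeriv m (-f) = -iteratedDeriv m f := by
    funext t
    simp [iteratedDeriv_neg]
  rw [h2] at h1
  exact neg_convexOn_iff.mp h1

/-- On a half-line, positivity of the Hankel matrices `f^(i+l+d) / (i+l+d)!` forces the
derivatives of order at least `d` to alternate in sign. -/
theorem neg_one_pow_mul_iteratedDeriv_nonneg {n d : ℕ}
    (hf : ContDiffOn ℝ N f (Ioi α)) (hN : 2 * n + d ≤ N + 2)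
    (hh : ∀ t ∈ Ioi α, ∀ c : Fin n → ℝ, 0 ≤ ∑ i : Fin n, ∑ l : Fin n, c i * c l *
      (iteratedDeriv (i + l + d) f t / (i + l + d : ℕ).factorial))
    {k : ℕ} (hk : k + 2 ≤ 2 * n) : ∀ t ∈ Ioi α, 0 ≤ (-1 : ℝ) ^ k * iteratedDeriv (k + d) f t := by
  have hdiag : ∀ j < n, ∀ t ∈ Ioi α, 0 ≤ iteratedDeriv (2 * j + d) f t := by
    intro j hj t ht
    have h := (hankel_diag_nonneg_and_minor
      (h := fun k => iteratedDeriv k f t / k.factorial) (hh t ht)).1 j hj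
    simpa [div_mul_cancel₀, Nat.factorial_ne_zero] using
      mul_nonneg h (Nat.cast_nonneg (α := ℝ) (2 * j + d).factorial)
  rcases Nat.even_or_odd' k with ⟨j, rfl | rfl⟩
  · intro t ht
    rw [Even.neg_one_pow (even_two_mul j), one_mul]
    exact hdiag j (by omega) t ht
  · have hlt : 2 * j + d + 2 ≤ N := by omega
    -- With `p = 2 * j + d`, clearing factorials in the minor leaves the factor `(p + 2) / (p + 1) =
    -- 1 + 1 / (p + 1)`. Its excess over 1 is what makes the half-line argument work.
    have hnp := deriv_nonpos_of_mul_deriv2_ge (α := α) (c := 1 / ((2 * j + d : ℕ) + 1))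
      (g := iteratedDeriv (2 * j + d) f) (g₁ := iteratedDeriv (2 * j + d + 1) f)
      (g₂ := iteratedDeriv (2 * j + d + 2) f) (by positivity)
      (fun t ht => hasDerivAt_iteratedDeriv_of_contDiffOn isOpen_Ioi hf (by omega) ht)
      (fun t ht => hasDerivAt_iteratedDeriv_of_contDiffOn isOpen_Ioi hf (by omega) ht)
      (hdiag j (by omega))
      (fun t ht => by
        have := hdiag (j + 1) (by omega) t ht
        rwa [show 2 * (j + 1) + d = 2 * j + d + 2 by ring] at this)
      (fun t ht => by
        have h := (hankel_diag_nonneg_and_minor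
          (h := fun k => iteratedDeriv k f t / k.factorial) (hh t ht)).2 j (by omega)
        generalize 2 * j + d = p at *
        have hp : (0 : ℝ) < (p.factorial : ℝ) := by positivity
        rw [Nat.factorial_succ (p + 1), Nat.factorial_succ p] at h
        push_cast at h
        rw [div_pow, div_mul_div_comm, div_le_div_iff₀ (by positivity) (by positivity)] at h
        have h' : iteratedDeriv (p + 1) f t ^ 2 * (p + 2) * (p.factorial ^ 2 * (p + 1)) ≤
            iteratedDeriv p f t * iteratedDeriv (p + 2) f t * (p + 1) *
              (p.factorial ^ 2 * (p + 1)) := by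
          linarith
        have h2 := le_of_mul_le_mul_right h' (by positivity)
        have hp1 : (0 : ℝ) < p + 1 := by positivity
        rw [one_add_div hp1.ne', div_mul_eq_mul_div, div_le_iff₀ hp1]
        linarith)
    intro t ht
    rw [Odd.neg_one_pow (odd_two_mul_add_one j), neg_one_mul, neg_nonneg,
      show 2 * j + 1 + d = 2 * j + d + 1 by ring]
    exact hnp t ht

end Signs

theorem mainTheorem3 (n : ℕ) (hn : 1 ≤ n) (α : ℝ) (f : ℝ → ℝ) :
    (IsMatrixMonotoneOn n (Ioi α) f → ContDiffOn ℝ ((2 * n - 1 : ℕ) : WithTop ℕ∞) f (Ioi α) →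
      (∀ k : ℕ, k ≤ 2 * n - 2 → ∀ t ∈ Ioi α, 0 ≤ (-1 : ℝ) ^ k * iteratedDeriv (k + 1) f t) ∧
      (∀ m : ℕ, Even m → m + 4 ≤ 2 * n → ConcaveOn ℝ (Ioi α) (iteratedDeriv m f)) ∧
      (∀ m : ℕ, Odd m → m + 3 ≤ 2 * n → ConvexOn ℝ (Ioi α) (iteratedDeriv m f))) ∧
    (IsMatrixConvexOn n (Ioi α) f → ContDiffOn ℝ ((2 * n : ℕ) : WithTop ℕ∞) f (Ioi α) →
      (∀ k : ℕ, k ≤ 2 * n - 2 → ∀ t ∈ Ioi α, 0 ≤ (-1 : ℝ) ^ k * iteratedDeriv (k + 2) f t) ∧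
      (∀ m : ℕ, Even m → m + 2 ≤ 2 * n → ConvexOn ℝ (Ioi α) (iteratedDeriv m f)) ∧
      (∀ m : ℕ, Odd m → m + 3 ≤ 2 * n → ConcaveOn ℝ (Ioi α) (iteratedDeriv m f))) := by
  refine ⟨fun hf hd => ?_, fun hf hd => ?_⟩
  · have H : ∀ k : ℕ, k ≤ 2 * n - 2 → ∀ t ∈ Ioi α, 0 ≤ (-1 : ℝ) ^ k * iteratedDeriv (k + 1) f t :=
      fun k hk => neg_one_pow_mul_iteratedDeriv_nonneg hd (by omega)
        (fun t ht => hf.hankel_nonneg isOpen_Ioi (convex_Ioi α) ht hd) (by omega)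
    refine ⟨H, fun m hm hmn => ?_, fun m hm hmn => ?_⟩
    · refine concaveOn_iteratedDeriv isOpen_Ioi (convex_Ioi α) hd (by omega) fun t ht => ?_
      have := H (m + 1) (by omega) t ht
      rwa [hm.add_one.neg_one_pow, neg_one_mul, neg_nonneg] at this
    · refine convexOn_iteratedDeriv isOpen_Ioi (convex_Ioi α) hd (by omega) fun t ht => ?_
      have := H (m + 1) (by omega) t ht
      rwa [hm.add_one.neg_one_pow, one_mul] at this
  · have H : ∀ k : ℕ, k ≤ 2 * n - 2 → ∀ t ∈ Ioi α, 0 ≤ (-1 : ℝ) ^ k * iteratedDeriv (k + 2) f t :=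
      fun k hk => neg_one_pow_mul_iteratedDeriv_nonneg hd (by omega)
        (fun t ht => hf.hankel_nonneg isOpen_Ioi (convex_Ioi α) ht hd) (by omega)
    refine ⟨H, fun m hm hmn => ?_, fun m hm hmn => ?_⟩
    · refine convexOn_iteratedDeriv isOpen_Ioi (convex_Ioi α) hd (by omega) fun t ht => ?_
      have := H m (by omega) t ht
      rwa [hm.neg_one_pow, one_mul] at this
    · refine concaveOn_iteratedDeriv isOpen_Ioi (convex_Ioi α) hd (by omega) fun t ht => ?_
      have := H m (by omega) t ht
      rwa [hm.neg_one_pow, neg_one_mul, neg_nonneg] at this
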